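/- **Setting.** Let $K,L,N\ge 1$ be integers. In the $(K,L,M,N)$ multi-access caching system a server holds $N$ files $W_1,\dots,W_N$ of size $1$ unit each; there are $K$ cache-nodes $C_1,\dots,C_K$ with a memory of $M$ units each, and $K$ users $U_1,\dots,U_K$ without caches, where $U_i$ has access to the $L$ consecutive cache-nodes $C_i,C_{i+1},\dots,C_{i+L-1}$ (indices modulo $K$). A coded caching scheme with subpacketization $F$ divides each file into $F$ packets of equal size. In the placement phase uncoded packets are stored in the cache-nodes, within their memory and without knowledge of the requests. In the delivery phase each user $U_i$ requests a file $W_{d_i}$, and, given $\mathbf d=(d_1,\dots,d_K)\in\{1,\dots,N\}^K$, the server broadcasts coded messages of total size $R_{\mathbf d}$ units to all users, such that each user recovers its requested file from these messages and the contents of its accessible cache-nodes. The rate of the scheme is $R=\max_{\mathbf d}R_{\mathbf d}$. Let $M=\frac{\gamma}{K}N$ with $\gamma\in\{0,1,\dots,\lfloor K/L\rfloor\}$. The *consecutive cyclic placement* splits each file $W_n$ into $K$ subfiles $W_{n,1},\dots,W_{n,K}$ of equal length (each subfile possibly being divided further into packets), and $C_k$ stores exactly the subfiles $W_{n,k-L+1},W_{n,k-2L+1},\dots,W_{n,k-\gamma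 L+1}$ (second indices modulo $K$) of all files, $n=1,\dots,N$. For positive integers $a,q$ let $\langle a\rangle_q=q$ if $q\mid a$, and otherwise let $\langle a\rangle_q$ be the least non-negative residue of $a$ modulo $q$. **Theorem 2.** With $t=\gamma L$, there is a coded caching scheme for the $(K,L,M,N)$ multi-access caching system, with the consecutive cyclic placement, whose rate is $$R_{new}=\begin{cases}\dfrac{(K-t)(K-t+1)}{2K}, & \text{if } (K-t+1)\mid K \text{ or } K-t=1,\\[2mm] \dfrac{K-t}{2\lfloor \frac{K}{K-t+1}\rfloor+1}, & \text{if } \langle K\rangle_{K-t+1}=K-t \text{ and } K-t>1,\\[2mm] \dfrac{K-t}{2\lfloor \frac{K}{K-t+1}\rfloor}, & \text{otherwise,}\end{cases}$$ and whose subpacketization is $$F_{new}=\begin{cases}K, & \text{if } (K-t+1)\mid K \text{ or } K-t=1,\\ \left(2\lfloor \frac{K}{K-t+1}\rfloor+1\right)K, & \text{if } \langle K\rangle_{K-t+1}=K-t \text{ and } K-t>1,\\ 2\lfloor \frac{K}{K-t+1}\rfloor K, & \text{otherwise.}\end{cases}$$ -/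

import Mathlib

/-- The residue `⟨a⟩_q` of `a` modulo `q` in the range `1, …, q`: the least non-negative residue if
`q` does not divide `a`, and `q` otherwise. -/
def cyclicResidue (a q : ℕ) : ℕ := if q ∣ a then q else a % q

/-- A packet of `B` bits. -/
abbrev Packet (B : ℕ) : Type := Fin B → ZMod 2

/-- The contents of a library of `N` files, each of them divided into `F` packets of `B` bits. A file
(`F * B` bits) has size one unit, so a packet has size `1 / F` units. -/
abbrev Library (N F B : ℕ) : Type := Fin N → Fin F → Packet B

/-- A request vector: user `i` requests the file `d i`. Users and cache-nodes are numbered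
cyclically, by `ZMod K`. -/
abbrev RequestVector (K N : ℕ) : Type := ZMod K → Fin N

/-- The cache-nodes `i, i + 1, …, i + L - 1` (cyclically) that user `i` has access to. -/
def accessibleNodes (K L : ℕ) (i : ZMod K) : Set (ZMod K) :=
  {c | ∃ l : ℕ, l < L ∧ c = i + (l : ZMod K)}

/-- The packets `(n, p)` (packet `p` of file `n`) which user `i` can retrieve from its cache-nodes,
when cache-node `c` stores the packets in `cache c`. -/
def retrievable {K N F : ℕ} (L : ℕ) (cache : ZMod K → Finset (Fin N × Fin F)) (i : ZMod K) :
    Set (Fin N × Fin F) :=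
  {x | ∃ c ∈ accessibleNodes K L i, x ∈ cache c}

/-- A coded caching scheme with uncoded placement and subpacketization `F` (with packets of `B` bits)
for the `(K, L, M, N)` multi-access caching system. -/
structure MultiAccessScheme (K L : ℕ) (M : ℝ) (N F B : ℕ) where
  /-- Placement phase: the packets stored in each cache-node, chosen before the requests. -/
  cache : ZMod K → Finset (Fin N × Fin F)
  /-- A cache-node has a memory of `M` units. -/
  memory_le : ∀ c, ((cache c).card : ℝ) / (F : ℝ) ≤ M
  /-- Delivery phase: the number of coded messages (each of the size of a packet) that the server
  broadcasts. -/
  numMessages : RequestVector K N → ℕ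
  /-- The broadcast messages. -/
  broadcast : (d : RequestVector K N) → Library N F B → Fin (numMessages d) → Packet B
  /-- The decoder of each user: it sees the requests, the packets that the user can retrieve from
  its cache-nodes, and the broadcast messages. -/
  decode : (i : ZMod K) → (d : RequestVector K N) → (retrievable L cache i → Packet B) →
    (Fin (numMessages d) → Packet B) → Fin F → Packet B
  /-- Each user recovers the file that it requests. -/
  decode_eq : ∀ (i : ZMod K) (d : RequestVector K N) (W : Library N F B),
    decode i d (fun x => W x.1.1 x.1.2) (broadcast d W) = W (d i)

namespace MultiAccessScheme

variable {K L N F B : ℕ} {M : ℝ}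

/-- `R` is the transmission rate of the scheme: the maximum over all request vectors of the total
size, in units of a file, of the broadcast messages. -/
def HasRate (σ : MultiAccessScheme K L M N F B) (R : ℝ) : Prop :=
  IsGreatest (Set.range fun d : RequestVector K N => (σ.numMessages d : ℝ) / (F : ℝ)) R

/-- The consecutive cyclic placement: each file is split into `K` subfiles of equal length (`sub p`
is the subfile that packet `p` belongs to), and cache-node `c` stores, of every file, exactly the
subfiles with (cyclic) numbers `c - L + 1, c - 2 L + 1, …, c - γ L + 1`. -/
def IsConsecutiveCyclic (σ : MultiAccessScheme K L M N F B) (γ : ℕ) : Prop :=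
  ∃ sub : Fin F → ZMod K,
    (∀ j : ZMod K, K * Nat.card {p : Fin F // sub p = j} = F) ∧
    ∀ (c : ZMod K) (n : Fin N) (p : Fin F),
      (n, p) ∈ σ.cache c ↔
        ∃ r : ℕ, 1 ≤ r ∧ r ≤ γ ∧ sub p = c - (r : ZMod K) * (L : ZMod K) + 1

end MultiAccessScheme

/-- The rate `R_new`, for `t ≤ K`. -/
noncomputable def newRate (K t : ℕ) : ℝ :=
  if (K - t + 1) ∣ K ∨ K - t = 1 then
    ((K : ℝ) - t) * ((K : ℝ) - t + 1) / (2 * K)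
  else if cyclicResidue K (K - t + 1) = K - t ∧ 1 < K - t then
    ((K : ℝ) - t) / (2 * ((K / (K - t + 1) : ℕ) : ℝ) + 1)
  else
    ((K : ℝ) - t) / (2 * ((K / (K - t + 1) : ℕ) : ℝ))

/-- The subpacketization `F_new`, for `t ≤ K`. -/
def newSubpacketization (K t : ℕ) : ℕ :=
  if (K - t + 1) ∣ K ∨ K - t = 1 then
    K
  else if cyclicResidue K (K - t + 1) = K - t ∧ 1 < K - t then
    (2 * (K / (K - t + 1)) + 1) * K
  else
    2 * (K / (K - t + 1)) * K

/-! Put `k = K - γ * L`. User `i` has every subfile except possibly `i + 1, …, i + k`, so delivery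
is an index coding problem: if the demands (user, missing packet) are covered by cliques in which
each user holds the packets of all other members, one sum per clique suffices
(`exists_of_cliqueCover`). Three covers give the three rates. If `k + 1 ∣ K`, demands are grouped by
the pair of residues mod `k + 1` of user and subfile. If `k = 1`, all demands form one clique.
Otherwise (`exists_of_zigzag`) each subfile is cut into `T` packets, and a clique follows a sequence
round the cycle with gaps alternating `j`, `k + 1 - j`: each term wants the next, and any two steps
jump past the `k` missing subfiles. With `k * K` cliques of size `T` the rate is `k / T`, where `T`
is the number of steps that fit in the cycle. -/

namespace MultiAccessScheme

/-- The subfiles which cache-node `c` stores under the consecutive cyclic placement. -/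
def storedSubfiles (K L γ : ℕ) (c : ZMod K) : Finset (ZMod K) :=
  (Finset.Icc 1 γ).image fun r : ℕ => c - (r : ZMod K) * (L : ZMod K) + 1

theorem mem_storedSubfiles {K L γ : ℕ} {c x : ZMod K} :
    x ∈ storedSubfiles K L γ c ↔
      ∃ r : ℕ, 1 ≤ r ∧ r ≤ γ ∧ x = c - (r : ZMod K) * (L : ZMod K) + 1 := by
  simp only [storedSubfiles, Finset.mem_image, Finset.mem_Icc, and_assoc, eq_comm]

theorem card_storedSubfiles_le (K L γ : ℕ) (c : ZMod K) : (storedSubfiles K L γ c).card ≤ γ :=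
  Finset.card_image_le.trans (by simp)

/-- User `i` has access to all subfiles but `i + 1, …, i + (K - γ L)`. -/
theorem exists_accessible_of_eq_add {K L γ : ℕ} (hL : 0 < L) {i x : ZMod K} {v : ℕ}
    (hv : K - γ * L + 1 ≤ v) (hvK : v ≤ K) (hx : x = i + (v : ZMod K)) :
    ∃ c ∈ accessibleNodes K L i, x ∈ storedSubfiles K L γ c := by
  obtain ⟨w, hK⟩ := Nat.exists_eq_add_of_le hvK
  have hw : w < γ * L := by omega
  have hdiv : w / L < γ := Nat.div_lt_of_lt_mul (by rwa [mul_comm])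
  have hmod := Nat.mod_lt w hL
  -- Since `x = i - w`, division of `w` by `L` gives the node (remainder) and the stored multiple of
  -- `L` (quotient).
  refine ⟨i + ((L - 1 - w % L : ℕ) : ZMod K), ⟨_, by omega, rfl⟩, mem_storedSubfiles.2
    ⟨w / L + 1, Nat.le_add_left 1 _, hdiv, ?_⟩⟩
  have h1 : ((L - 1 - w % L : ℕ) : ZMod K) + 1 + ((w % L : ℕ) : ZMod K) = L := by
    norm_cast
    congr 1
    omega
  have h2 : ((w % L : ℕ) : ZMod K) + L * ((w / L : ℕ) : ZMod K) = w := by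
    exact_mod_cast congrArg (Nat.cast (R := ZMod K)) (Nat.mod_add_div w L)
  have h3 : (v : ZMod K) + w = 0 := by
    rw [← Nat.cast_add, ← hK, ZMod.natCast_self]
  rw [hx]
  push_cast
  linear_combination h3 + h2 - h1

/-- Offsets run over `1, …, K`, not `0, …, K - 1`, so that those beyond the missing range form one
interval ending at `K`. -/
theorem exists_eq_add_natCast {K : ℕ} [NeZero K] (i x : ZMod K) :
    ∃ v : ℕ, 1 ≤ v ∧ v ≤ K ∧ x = i + (v : ZMod K) := by
  refine ⟨(x - i - 1).val + 1, by omega, ZMod.val_lt _, ?_⟩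
  push_cast
  rw [ZMod.natCast_zmod_val]
  ring

/-! ### Schemes from clique covers -/

/-- The scheme with the consecutive cyclic placement that broadcasts, for each clique of demands
(user, packet), the sum of the demanded packets. -/
theorem exists_of_cliqueCover {K L N γ B : ℕ} [NeZero K] {M : ℝ} (hL : 0 < L) (hN : 0 < N)
    (hM : M = (γ : ℝ) * (N : ℝ) / (K : ℝ)) {F n : ℕ} (sub : Fin F → ZMod K)
    (hsub : ∀ j : ZMod K, K * Nat.card {p : Fin F // sub p = j} = F)
    (clique : Fin n → Finset (ZMod K × Fin F))
    (hcover : ∀ (i : ZMod K) (p : Fin F) (v : ℕ), 1 ≤ v → v ≤ K - γ * L → sub p = i + (v : ZMod K) →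
      ∃ m, (i, p) ∈ clique m ∧ ∀ y ∈ clique m, y ≠ (i, p) →
        ∃ v : ℕ, K - γ * L + 1 ≤ v ∧ v ≤ K ∧ sub y.2 = i + (v : ZMod K)) :
    ∃ σ : MultiAccessScheme K L M N F B,
      σ.IsConsecutiveCyclic γ ∧ σ.HasRate ((n : ℝ) / F) := by
  classical
  have hK : 0 < K := NeZero.pos K
  let cache : ZMod K → Finset (Fin N × Fin F) := fun c =>
    Finset.univ.filter fun x => sub x.2 ∈ storedSubfiles K L γ c
  have hret : ∀ (i : ZMod K) (a : Fin N) (p : Fin F) (v : ℕ), K - γ * L + 1 ≤ v → v ≤ K →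
      sub p = i + (v : ZMod K) → (a, p) ∈ retrievable L cache i := by
    intro i a p v h1 h2 h3
    obtain ⟨c, hc, hx⟩ := exists_accessible_of_eq_add hL h1 h2 h3
    exact ⟨c, hc, by simpa [cache] using hx⟩
  -- Storage treats all files alike, so the clique serving `(i, p)` can be chosen independently of
  -- the requests.
  have hcov : ∀ (i : ZMod K) (p : Fin F), (∃ a : Fin N, (a, p) ∉ retrievable L cache i) →
      ∃ m, (i, p) ∈ clique m ∧ ∀ y ∈ (clique m).erase (i, p), ∀ a : Fin N,
        (a, y.2) ∈ retrievable L cache i := by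
    rintro i p ⟨a, ha⟩
    obtain ⟨v, h1, h2, h3⟩ := exists_eq_add_natCast i (sub p)
    obtain ⟨m, hm, hm'⟩ := hcover i p v h1
      (by by_contra h; exact ha (hret i a p v (by omega) h2 h3)) h3
    refine ⟨m, hm, fun y hy b => ?_⟩
    obtain ⟨w, hw1, hw2, hw3⟩ := hm' y (Finset.mem_of_mem_erase hy) (Finset.ne_of_mem_erase hy)
    exact hret i b y.2 w hw1 hw2 hw3
  choose msg hmsg hknown using hcov
  have hmem : ∀ c, ((cache c).card : ℝ) / (F : ℝ) ≤ M := by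
    intro c
    have hfib : ∀ j : ZMod K, K * (Finset.univ.filter fun p : Fin F => sub p = j).card = F := by
      intro j
      rw [← Fintype.card_subtype, ← Nat.card_eq_fintype_card, hsub j]
    have hcard : K * (cache c).card ≤ γ * N * F := by
      have hsubset : cache c ⊆ (Finset.univ : Finset (Fin N)) ×ˢ
          ((storedSubfiles K L γ c).biUnion fun j => Finset.univ.filter fun p => sub p = j) := by
        intro x hx
        simpa [cache] using hx
      calc K * (cache c).card
          ≤ K * (N * ∑ j ∈ storedSubfiles K L γ c,
              (Finset.univ.filter fun p : Fin F => sub p = j).card) := by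
            gcongr
            refine (Finset.card_le_card hsubset).trans ?_
            rw [Finset.card_product, Finset.card_univ, Fintype.card_fin]
            gcongr
            exact Finset.card_biUnion_le
        _ = N * ((storedSubfiles K L γ c).card * F) := by
            rw [mul_left_comm, Finset.mul_sum]
            simp [hfib]
        _ ≤ N * (γ * F) := by
            gcongr
            exact card_storedSubfiles_le K L γ c
        _ = γ * N * F := by ring
    rcases Nat.eq_zero_or_pos F with rfl | hF
    · rw [hM]
      simp only [Nat.cast_zero, div_zero]
      positivity
    · rw [hM, div_le_div_iff₀ (by exact_mod_cast hF) (by exact_mod_cast hK)]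
      rw [mul_comm]
      exact_mod_cast hcard
  let σ : MultiAccessScheme K L M N F B :=
    { cache := cache
      memory_le := hmem
      numMessages := fun _ => n
      broadcast := fun d W m => ∑ y ∈ clique m, W (d y.1) y.2
      decode := fun i d known X p =>
        if h : (d i, p) ∈ retrievable L cache i then known ⟨(d i, p), h⟩
        else X (msg i p ⟨_, h⟩) - ∑ y ∈ (clique (msg i p ⟨_, h⟩)).erase (i, p),
          -- The default `0` never occurs, by `hknown`.
          if h : (d y.1, y.2) ∈ retrievable L cache i then known ⟨(d y.1, y.2), h⟩ else 0
      decode_eq := by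
        intro i d W
        funext p
        split_ifs with h
        · rfl
        · have hex : ∃ a : Fin N, (a, p) ∉ retrievable L cache i := ⟨_, h⟩
          beta_reduce
          rw [← Finset.add_sum_erase _ _ (hmsg i p hex), sub_eq_iff_eq_add]
          congr 1
          refine Finset.sum_congr rfl fun y hy => ?_
          rw [dif_pos (hknown i p hex y hy _)] }
  refine ⟨σ, ⟨sub, hsub, fun c a p => ?_⟩, ⟨fun _ => ⟨0, hN⟩, rfl⟩, ?_⟩
  · simp only [σ, cache, Finset.mem_filter, Finset.mem_univ, true_and]
    exact mem_storedSubfiles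
  · rintro _ ⟨d, rfl⟩
    exact le_rfl

/-- The scheme of a clique cover in which each subfile is divided into `T` packets, with messages
numbered by a finite type `ι`. -/
theorem exists_of_cliqueCover_prod {K L N γ B : ℕ} [NeZero K] {M : ℝ} (hL : 0 < L) (hN : 0 < N)
    (hM : M = (γ : ℝ) * (N : ℝ) / (K : ℝ)) {F T : ℕ} (hF : T * K = F) {ι : Type*} [Fintype ι]
    (clique : ι → Finset (ZMod K × ZMod K × Fin T))
    (hcover : ∀ (i : ZMod K) (s : Fin T) (v : ℕ), 1 ≤ v → v ≤ K - γ * L →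
      ∃ m, (i, i + (v : ZMod K), s) ∈ clique m ∧
        ∀ y ∈ clique m, y ≠ (i, i + (v : ZMod K), s) →
          ∃ v : ℕ, K - γ * L + 1 ≤ v ∧ v ≤ K ∧ y.2.1 = i + (v : ZMod K)) :
    ∃ σ : MultiAccessScheme K L M N F B,
      σ.IsConsecutiveCyclic γ ∧ σ.HasRate ((Fintype.card ι : ℝ) / F) := by
  classical
  have hcard : Fintype.card (ZMod K × Fin T) = F := by
    rw [Fintype.card_prod, ZMod.card, Fintype.card_fin, mul_comm, hF]
  let e : Fin F ≃ ZMod K × Fin T := (Fintype.equivFinOfCardEq hcard).symm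
  let f : Fin (Fintype.card ι) ≃ ι := (Fintype.equivFin ι).symm
  refine exists_of_cliqueCover hL hN hM (fun p => (e p).1) (fun j => ?_)
    (fun m => (clique (f m)).map ((Equiv.refl _).prodCongr e.symm).toEmbedding) ?_
  · have h1 : Nat.card {p : Fin F // (e p).1 = j} = T := by
      rw [Nat.card_congr (e.subtypeEquiv (q := fun x => x.1 = j) fun _ => Iff.rfl),
        Nat.card_eq_fintype_card, Fintype.card_subtype]
      have h2 : (Finset.univ.filter fun x : ZMod K × Fin T => x.1 = j) =
          {j} ×ˢ Finset.univ := by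
        ext x
        simp only [Finset.mem_filter, Finset.mem_univ, true_and, Finset.mem_product,
          Finset.mem_singleton, and_true]
      rw [h2]
      simp
    rw [h1, mul_comm, hF]
  · intro i p v h1 h2 h3
    obtain ⟨m, hm, hm'⟩ := hcover i (e p).2 v h1 h2
    rw [← h3] at hm hm'
    refine ⟨f.symm m, ?_, ?_⟩
    · rw [f.apply_symm_apply, Finset.mem_map]
      exact ⟨_, hm, by simp⟩
    · intro y hy hne
      rw [f.apply_symm_apply, Finset.mem_map] at hy
      obtain ⟨z, hz, rfl⟩ := hy
      obtain ⟨w, hw⟩ := hm' z hz (by rintro rfl; exact hne (by simp))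
      exact ⟨w, by simpa using hw⟩

/-! ### Covers without further division of subfiles -/

/-- If `k + 1` divides `K`, where `k = K - γ L`, then one message suffices for each unordered pair
of residues modulo `k + 1`. -/
theorem exists_of_dvd {K L N γ B : ℕ} [NeZero K] {M : ℝ} (hL : 0 < L) (hN : 0 < N)
    (hM : M = (γ : ℝ) * (N : ℝ) / (K : ℝ)) (hdvd : K - γ * L + 1 ∣ K) :
    ∃ σ : MultiAccessScheme K L M N K B, σ.IsConsecutiveCyclic γ ∧
      σ.HasRate (((K - γ * L + 1).choose 2 : ℕ) / (K : ℝ)) := by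
  classical
  set k := K - γ * L with hk
  let φ : ZMod K →+* ZMod (k + 1) := ZMod.castHom hdvd _
  have hφ : ∀ v w : ℕ, v ≤ k → w ≤ k → (v : ZMod (k + 1)) = w → v = w := by
    intro v w hv hw h
    rw [ZMod.natCast_eq_natCast_iff'] at h
    rwa [Nat.mod_eq_of_lt (by omega), Nat.mod_eq_of_lt (by omega)] at h
  let clique : {z : Sym2 (ZMod (k + 1)) // ¬ z.IsDiag} → Finset (ZMod K × ZMod K × Fin 1) :=
    fun z => Finset.univ.filter fun y =>
      (∃ v : ℕ, 1 ≤ v ∧ v ≤ k ∧ y.2.1 = y.1 + (v : ZMod K)) ∧ z.1 = s(φ y.1, φ y.2.1)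
  have key := exists_of_cliqueCover_prod (B := B) hL hN hM (one_mul K) clique ?_
  · rwa [Sym2.card_subtype_not_diag, ZMod.card] at key
  intro i s v h1 h2
  refine ⟨⟨s(φ i, φ (i + v)), ?_⟩, ?_, ?_⟩
  · rw [Sym2.mk_isDiag_iff, map_add, map_natCast]
    intro h
    have := hφ v 0 h2 (by omega) (by simpa using h)
    omega
  · exact Finset.mem_filter.2 ⟨Finset.mem_univ _, ⟨v, h1, h2, rfl⟩, rfl⟩
  · rintro ⟨i', x', s'⟩ hy hne
    simp only [clique, Finset.mem_filter, Finset.mem_univ, true_and] at hy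
    obtain ⟨⟨v', hv1, hv2, rfl⟩, hz⟩ := hy
    obtain ⟨w, hw1, hw2, hw⟩ := exists_eq_add_natCast i (i' + (v' : ZMod K))
    refine ⟨w, ?_, hw2, hw⟩
    by_contra! hlt
    rw [hw, Sym2.eq_iff] at hz
    simp only [map_add, map_natCast] at hz
    -- Residues mod `k + 1` separate `0, …, k`: equal orientation forces the same demand, opposite
    -- orientation forces `w ≡ 0`.
    rcases hz with ⟨hi, hvw⟩ | ⟨hi, -⟩
    · have hvw' : v = w := hφ v w h2 (by omega) (by simpa using hvw)
      have hφw := congrArg φ hw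
      simp only [map_add, map_natCast, ← hi] at hφw
      have hvv : v' = w := hφ v' w hv2 (by omega) (by simpa using hφw)
      subst hvv hvw'
      exact hne (by rw [add_right_cancel hw, Subsingleton.elim s' s])
    · have := hφ w 0 (by omega) (by omega) (by simpa using hi)
      omega

/-- If every user misses one subfile, then one message suffices. -/
theorem exists_of_sub_eq_one {K L N γ B : ℕ} [NeZero K] {M : ℝ} (hL : 0 < L) (hN : 0 < N)
    (hM : M = (γ : ℝ) * (N : ℝ) / (K : ℝ)) (hk : K - γ * L = 1) :
    ∃ σ : MultiAccessScheme K L M N K B, σ.IsConsecutiveCyclic γ ∧ σ.HasRate (1 / (K : ℝ)) := by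
  classical
  let clique : Unit → Finset (ZMod K × ZMod K × Fin 1) :=
    fun _ => Finset.univ.filter fun y => y.2.1 = y.1 + 1
  have key := exists_of_cliqueCover_prod (B := B) hL hN hM (one_mul K) clique ?_
  · simpa using key
  intro i s v h1 h2
  obtain rfl : v = 1 := by omega
  refine ⟨(), by simp [clique], ?_⟩
  rintro ⟨i', x', s'⟩ hy hne
  simp only [clique, Finset.mem_filter, Finset.mem_univ, true_and] at hy
  subst hy
  obtain ⟨w, hw1, hw2, hw⟩ := exists_eq_add_natCast i (i' + 1)
  refine ⟨w, ?_, hw2, hw⟩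
  by_contra! hlt
  obtain rfl : w = 1 := by omega
  have hi : i' = i := by simpa using hw
  exact hne (by rw [hi, Subsingleton.elim s' s, Nat.cast_one])

/-! ### Zigzag covers -/

/-- The sequence `0, j, k + 1, k + 1 + j, 2 (k + 1), …` with alternating gaps `j` and `k + 1 - j`. -/
def zigzag (k j s : ℕ) : ℕ := s / 2 * (k + 1) + s % 2 * j

theorem zigzag_add_two (k j s : ℕ) : zigzag k j (s + 2) = zigzag k j s + (k + 1) := by
  simp only [zigzag, Nat.add_mod_right, Nat.add_div_right s two_pos]
  ring

theorem zigzag_mono {k j : ℕ} (hj : j ≤ k) : Monotone (zigzag k j) := by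
  refine monotone_nat_of_le_succ fun s => ?_
  induction s using Nat.twoStepInduction with
  | zero => simp [zigzag]
  | one => simp [zigzag]; omega
  | more s ih _ => rw [zigzag_add_two, zigzag_add_two]; omega

/-- Any gap `v` occurs at any place `s` of a suitable sequence. -/
theorem exists_zigzag_succ (k s : ℕ) {v : ℕ} (h1 : 1 ≤ v) (h2 : v ≤ k) :
    ∃ j, 1 ≤ j ∧ j ≤ k ∧ zigzag k j (s + 1) = zigzag k j s + v := by
  induction s using Nat.twoStepInduction with
  | zero => exact ⟨v, h1, h2, by simp [zigzag]⟩
  | one => exact ⟨k + 1 - v, by omega, by omega, by simp [zigzag]; omega⟩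
  | more s ih _ =>
    obtain ⟨j, hj1, hj2, hj⟩ := ih
    refine ⟨j, hj1, hj2, ?_⟩
    rw [zigzag_add_two, zigzag_add_two, hj]
    omega

/-- With each subfile divided into `T` packets, `k K` messages suffice, where `k = K - γ L`: message
`(i, j)` serves the users `i + zigzag k j s` for `s < T`. -/
theorem exists_of_zigzag {K L N γ B : ℕ} [NeZero K] {M : ℝ} (hL : 0 < L) (hN : 0 < N)
    (hM : M = (γ : ℝ) * (N : ℝ) / (K : ℝ)) {T : ℕ}
    (hT : ∀ j, 1 ≤ j → j ≤ K - γ * L → zigzag (K - γ * L) j T ≤ K)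
    (hlast : ∀ j s, 1 ≤ j → j ≤ K - γ * L → s < T →
      zigzag (K - γ * L) j s + (K - γ * L) < j + K) :
    ∃ σ : MultiAccessScheme K L M N (T * K) B, σ.IsConsecutiveCyclic γ ∧
      σ.HasRate ((K - γ * L : ℕ) / (T : ℝ)) := by
  classical
  set k := K - γ * L with hk
  let clique : ZMod K × Fin k → Finset (ZMod K × ZMod K × Fin T) := fun m =>
    Finset.univ.image fun s : Fin T =>
      (m.1 + (zigzag k (m.2 + 1) s : ZMod K), m.1 + (zigzag k (m.2 + 1) (s + 1) : ZMod K), s)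
  have key := exists_of_cliqueCover_prod (B := B) hL hN hM (rfl : T * K = T * K) clique ?_
  · have hK : (K : ℝ) ≠ 0 := by exact_mod_cast NeZero.ne K
    rw [Fintype.card_prod, ZMod.card, Fintype.card_fin, mul_comm K k, Nat.cast_mul, Nat.cast_mul,
      mul_div_mul_right _ _ hK] at key
    exact key
  intro i s v h1 h2
  obtain ⟨j, hj1, hj2, hj⟩ := exists_zigzag_succ k s h1 h2
  have hj' : j - 1 + 1 = j := by omega
  -- The start is shifted back so that user `i` is the `s`-th term.
  refine ⟨(i - (zigzag k j s : ZMod K), ⟨j - 1, by omega⟩), ?_, ?_⟩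
  · refine Finset.mem_image.2 ⟨s, Finset.mem_univ _, ?_⟩
    simp only [hj', hj]
    push_cast
    ring_nf
  · intro y hy hne
    obtain ⟨s', -, rfl⟩ := Finset.mem_image.1 hy
    simp only [hj'] at hne ⊢
    have hmono := zigzag_mono hj2
    have hss : (s' : ℕ) ≠ s := by
      intro h
      obtain rfl := Fin.ext h
      apply hne
      rw [hj]
      push_cast
      ring_nf
    rcases lt_or_gt_of_ne hss with hlt | hgt
    -- An earlier packet is reached by going round the cycle; `hlast` makes this offset exceed `k`.
    · have hle : zigzag k j (s' + 1) ≤ zigzag k j s := hmono hlt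
      have hge : zigzag k j 1 ≤ zigzag k j (s' + 1) := hmono (by omega)
      have hone : zigzag k j 1 = j := by simp [zigzag]
      have := hlast j s hj1 hj2 s.2
      have hsK : zigzag k j s ≤ K := (hmono s.2.le).trans (hT j hj1 hj2)
      refine ⟨K + zigzag k j (s' + 1) - zigzag k j s, by omega, by omega, ?_⟩
      rw [Nat.cast_sub (by omega)]
      push_cast
      rw [ZMod.natCast_self]
      ring
    -- A later packet is at least two gaps ahead, hence at offset at least `k + 1`; `hT` bounds it
    -- by `K`.
    · have hge : zigzag k j (s + 2) ≤ zigzag k j (s' + 1) := hmono (by omega)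
      rw [zigzag_add_two] at hge
      have hle : zigzag k j (s' + 1) ≤ K := (hmono s'.2).trans (hT j hj1 hj2)
      refine ⟨zigzag k j (s' + 1) - zigzag k j s, by omega, by omega, ?_⟩
      rw [Nat.cast_sub (by omega)]
      ring

end MultiAccessScheme

open MultiAccessScheme in
theorem theorem2 (K L N γ B : ℕ) (M : ℝ) (hK : 0 < K) (hL : 0 < L) (hN : 0 < N) (hB : 0 < B)
    (hγ : γ ≤ K / L) (hM : M = (γ : ℝ) * (N : ℝ) / (K : ℝ)) :
    ∃ σ : MultiAccessScheme K L M N (newSubpacketization K (γ * L)) B,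
      σ.IsConsecutiveCyclic γ ∧ σ.HasRate (newRate K (γ * L)) := by
  have : NeZero K := ⟨hK.ne'⟩
  have ht : γ * L ≤ K := (Nat.le_div_iff_mul_le hL).1 hγ
  have hcast : (K : ℝ) - ((γ * L : ℕ) : ℝ) = ((K - γ * L : ℕ) : ℝ) := (Nat.cast_sub ht).symm
  have hqr := Nat.div_add_mod K (K - γ * L + 1)
  rw [mul_comm] at hqr
  rw [newSubpacketization, newRate, hcast]
  by_cases h1 : K - γ * L + 1 ∣ K ∨ K - γ * L = 1
  · rw [if_pos h1, if_pos h1]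
    by_cases hdvd : K - γ * L + 1 ∣ K
    · have key := exists_of_dvd (B := B) hL hN hM hdvd
      rw [Nat.cast_choose_two] at key
      have hrate : ((K - γ * L : ℕ) : ℝ) * (((K - γ * L : ℕ) : ℝ) + 1) / (2 * K) =
          ((K - γ * L + 1 : ℕ) : ℝ) * (((K - γ * L + 1 : ℕ) : ℝ) - 1) / 2 / K := by
        rw [div_div, Nat.cast_add, Nat.cast_one]
        ring
      rwa [hrate]
    · have hk := h1.resolve_left hdvd
      have key := exists_of_sub_eq_one (B := B) hL hN hM hk
      rw [hk, Nat.cast_one, one_add_one_eq_two, one_mul, ← div_div, div_self two_ne_zero]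
      exact key
  rw [if_neg h1, if_neg h1]
  by_cases h2 : cyclicResidue K (K - γ * L + 1) = K - γ * L ∧ 1 < K - γ * L
  · rw [if_pos h2, if_pos h2]
    have hmod : K % (K - γ * L + 1) = K - γ * L := by
      have := h2.1
      rwa [cyclicResidue, if_neg fun h => h1 (Or.inl h)] at this
    rw [hmod] at hqr
    -- Remainder `k` leaves room after the full double steps for one more gap `j ≤ k`.
    have key := exists_of_zigzag (B := B) (T := 2 * (K / (K - γ * L + 1)) + 1) hL hN hM ?_ ?_
    · exact_mod_cast key
    · intro j _ hj
      have hd : (2 * (K / (K - γ * L + 1)) + 1) / 2 = K / (K - γ * L + 1) := by omega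
      have hm : (2 * (K / (K - γ * L + 1)) + 1) % 2 = 1 := by omega
      rw [zigzag, hd, hm]
      omega
    · intro j s hj1 hj hs
      have hle := zigzag_mono hj (Nat.lt_succ_iff.1 hs)
      rw [zigzag, zigzag, Nat.mul_div_cancel_left _ two_pos, Nat.mul_mod_right] at hle
      rw [zigzag]
      omega
  · rw [if_neg h2, if_neg h2]
    have key := exists_of_zigzag (B := B) (T := 2 * (K / (K - γ * L + 1))) hL hN hM ?_ ?_
    · exact_mod_cast key
    · intro j _ hj
      rw [zigzag, Nat.mul_div_cancel_left _ two_pos, Nat.mul_mod_right]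
      omega
    · intro j s hj1 hj hs
      -- With `q` the quotient, term `s + 2` is at most `q * (k + 1) + j ≤ K + j`, and it exceeds
      -- term `s` by `k + 1`.
      have hle := zigzag_mono hj (show s + 2 ≤ 2 * (K / (K - γ * L + 1)) + 1 by omega)
      have hd : (2 * (K / (K - γ * L + 1)) + 1) / 2 = K / (K - γ * L + 1) := by omega
      have hm : (2 * (K / (K - γ * L + 1)) + 1) % 2 = 1 := by omega
      rw [zigzag_add_two] at hle
      rw [zigzag, zigzag, hd, hm] at hle
      rw [zigzag]
      omega
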